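/- Let $G$ be a locally compact group and $K\le G$ a compact subgroup such that $(G,K)$ is a Gelfand pair, i.e. the convolution algebra of compactly supported continuous complex-valued functions $f$ on $G$ with $f(kxl)=f(x)$ for all $k,l\in K$, $x\in G$ is commutative (convolution being taken with respect to a left Haar measure). Assume that $G$ is compactly generated, i.e. generated by a compact subset. Let $\alpha$ be a continuous action of $G$ by isometries on a real Hilbert space $\mathscr{H}$ (so $(g,v)\mapsto\alpha(g)v$ is continuous on $G\times\mathscr{H}$), and let $\pi(g)v=\alpha(g)v-\alpha(g)0$ be its linear part. Assume that $\pi$ is irreducible, i.e. $\mathscr{H}\ne 0$ and the only closed $\pi(G)$-invariant real linear subspaces of $\mathscr{H}$ are $0$ and $\mathscr{H}$. If there is an element $g\in G$ with positive displacement length, i.e. $\inf_{v\in\mathscr{H}}\|\alpha(g)v-v\|>0$, then $\mathscr{H}$ is the only non-empty closed convex subset $C\subseteq\mathscr{H}$ that is $G$-invariant (i.e. $\alpha(g)C\subseteq C$ for all $g\in G$). -/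

import Mathlib

open MeasureTheory

/-- A topological group is compactly generated if it is generated, as an abstract group,
by a compact subset. -/
def IsCompactlyGeneratedGroup (G : Type*) [Group G] [TopologicalSpace G] : Prop :=
  ∃ S : Set G, IsCompact S ∧ Subgroup.closure S = ⊤

/-- Underlying space of the Hecke algebra of `(G, K)`: the compactly supported continuous
complex functions on `G` that are invariant under left and right translation by `K`. -/
def heckeSpace {G : Type*} [Group G] [TopologicalSpace G] (K : Subgroup G) :
    Submodule ℂ (G → ℂ) where
  carrier := {f | Continuous f ∧ HasCompactSupport f ∧
    ∀ k ∈ K, ∀ l ∈ K, ∀ x : G, f (k * x * l) = f x}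
  zero_mem' := ⟨continuous_const, HasCompactSupport.zero, fun _ _ _ _ _ => rfl⟩
  add_mem' := fun {f h} hf hh => ⟨hf.1.add hh.1, hf.2.1.add hh.2.1, fun k hk l hl x => by
    simp [hf.2.2 k hk l hl x, hh.2.2 k hk l hl x]⟩
  smul_mem' := fun c f hf => ⟨continuous_const.mul hf.1, hf.2.1.mul_left, fun k hk l hl x => by
    simp [hf.2.2 k hk l hl x]⟩

/-- Convolution of two complex functions on a locally compact group, with respect to
left Haar measure. -/
noncomputable def groupConvolution {G : Type*} [Group G] [TopologicalSpace G]
    [IsTopologicalGroup G] [LocallyCompactSpace G] [MeasurableSpace G] [BorelSpace G]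
    (f h : G → ℂ) (x : G) : ℂ :=
  ∫ y, f y * h (y⁻¹ * x) ∂(Measure.haar : Measure G)

/-- `(G, K)` is a Gelfand pair: `K` is a compact subgroup of the locally compact group `G`, and
convolution of compactly supported bi-`K`-invariant continuous functions is commutative. -/
structure IsGelfandPair {G : Type*} [Group G] [TopologicalSpace G]
    [IsTopologicalGroup G] [LocallyCompactSpace G] [MeasurableSpace G] [BorelSpace G]
    (K : Subgroup G) : Prop where
  isCompact : IsCompact (K : Set G)
  convolution_comm : ∀ f ∈ heckeSpace K, ∀ h ∈ heckeSpace K,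
    groupConvolution f h = groupConvolution h f

/-- The linear part `π` of an isometric action `α` on a real Hilbert space:
`π g v = α g v - α g 0`, which is a linear isometry by the Mazur–Ulam theorem. -/
noncomputable def linearPart {G H : Type*} [Group G] [NormedAddCommGroup H]
    [InnerProductSpace ℝ H] (α : G →* (H ≃ᵢ H)) : G →* (H ≃ₗᵢ[ℝ] H) :=
  MonoidHom.mk' (fun g => (α g).toRealLinearIsometryEquiv) fun a b => by
    ext v
    have h := (α a).toRealLinearIsometryEquiv.map_sub (α b v) (α b 0)
    simp only [IsometryEquiv.toRealLinearIsometryEquiv_apply] at h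
    change _ = (α a).toRealLinearIsometryEquiv ((α b).toRealLinearIsometryEquiv v)
    simp only [map_mul, IsometryEquiv.mul_apply, IsometryEquiv.toRealLinearIsometryEquiv_apply]
    rw [h]
    abel

/-- The defining formula of the linear part. -/
theorem linearPart_apply {G H : Type*} [Group G] [NormedAddCommGroup H]
    [InnerProductSpace ℝ H] (α : G →* (H ≃ᵢ H)) (g : G) (v : H) :
    linearPart α g v = α g v - α g 0 :=
  (α g).toRealLinearIsometryEquiv_apply v

/-- Topological irreducibility of an orthogonal representation: the space is nonzero and its only
closed invariant linear subspaces are `0` and the whole space. -/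
structure IsTopIrreducible {G H : Type*} [Group G] [NormedAddCommGroup H]
    [InnerProductSpace ℝ H] (π : G →* (H ≃ₗᵢ[ℝ] H)) : Prop where
  nontrivial : Nontrivial H
  eq_bot_or_eq_top : ∀ V : Submodule ℝ H, IsClosed (V : Set H) →
    (∀ g : G, ∀ v ∈ V, π g v ∈ V) → V = ⊥ ∨ V = ⊤

/-- The displacement (translation) length of an isometry: the infimum of the distances by which
it moves points. -/
noncomputable def displacementLength {X : Type*} [MetricSpace X] (φ : X ≃ᵢ X) : ℝ :=
  ⨅ x : X, dist (φ x) x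

open Filter Topology

/-! Write `α g v = π g v + α g 0`. By von Neumann's mean ergodic theorem, `α (g ^ n) 0 / n`
converges to a `π g`-fixed vector `w`, the drift of `g`. Each of these quotients (`n > 0`) is the
displacement of an average of orbit points, so `‖w‖` is at least the displacement length and `w ≠
0`. In an invariant closed convex `C`, segments from `x` to the far orbit points `α (g ^ n) x` force
the ray `x + t • w`, `t ≥ 0`, into `C`; using `g⁻¹`, with drift `-w`, gives the whole line. The
directions of such lines form a closed `π`-invariant subspace, which irreducibility makes all of
`H`. -/

/-- An isometry decomposes as its linear part followed by a translation. -/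
theorem apply_eq_linearPart_add {G H : Type*} [Group G] [NormedAddCommGroup H]
    [InnerProductSpace ℝ H] (α : G →* (H ≃ᵢ H)) (g : G) (v : H) :
    α g v = linearPart α g v + α g 0 := by
  rw [linearPart_apply]; abel

theorem apply_add_eq {G H : Type*} [Group G] [NormedAddCommGroup H]
    [InnerProductSpace ℝ H] (α : G →* (H ≃ᵢ H)) (g : G) (u v : H) :
    α g (u + v) = α g u + linearPart α g v := by
  rw [apply_eq_linearPart_add, map_add, apply_eq_linearPart_add α g u]; abel

/-- The directions along which every line through a point of `C` stays in `C`. -/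
def linealitySubmodule {H : Type*} [AddCommGroup H] [Module ℝ H] (C : Set H) :
    Submodule ℝ H where
  carrier := {u | ∀ x ∈ C, ∀ t : ℝ, x + t • u ∈ C}
  zero_mem' := fun x hx t => by simpa using hx
  add_mem' := fun {u v} hu hv x hx t => by
    rw [smul_add, ← add_assoc]
    exact hv _ (hu x hx t) t
  smul_mem' := fun c u hu x hx t => by
    rw [smul_smul]
    exact hu x hx (t * c)

theorem mem_linealitySubmodule {H : Type*} [AddCommGroup H] [Module ℝ H] {C : Set H} {u : H} :
    u ∈ linealitySubmodule C ↔ ∀ x ∈ C, ∀ t : ℝ, x + t • u ∈ C :=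
  Iff.rfl

theorem isClosed_linealitySubmodule {H : Type*} [NormedAddCommGroup H] [NormedSpace ℝ H]
    {C : Set H} (hC : IsClosed C) : IsClosed (linealitySubmodule C : Set H) := by
  have : (linealitySubmodule C : Set H) =
      ⋂ x ∈ C, ⋂ t : ℝ, (fun u : H => x + t • u) ⁻¹' C := by
    ext u
    simp [mem_linealitySubmodule]
  rw [this]
  exact isClosed_biInter fun x _ => isClosed_iInter fun t => hC.preimage (by fun_prop)

theorem eq_univ_of_linealitySubmodule_eq_top {H : Type*} [AddCommGroup H] [Module ℝ H]
    {C : Set H} (hne : C.Nonempty) (h : linealitySubmodule C = ⊤) : C = Set.univ := by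
  obtain ⟨x, hx⟩ := hne
  refine Set.eq_univ_of_forall fun y => ?_
  have hy : y - x ∈ linealitySubmodule C := h ▸ Submodule.mem_top
  simpa using hy x hx 1

/-- Pull `x` back by `g⁻¹`, move along `u` inside `C`, then return by `g`. -/
theorem linearPart_mem_linealitySubmodule {G H : Type*} [Group G] [NormedAddCommGroup H]
    [InnerProductSpace ℝ H] (α : G →* (H ≃ᵢ H)) {C : Set H}
    (hinv : ∀ g : G, ∀ x ∈ C, α g x ∈ C) (g : G) {u : H} (hu : u ∈ linealitySubmodule C) :
    linearPart α g u ∈ linealitySubmodule C := by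
  intro x hx t
  have h := hinv g _ (hu _ (hinv g⁻¹ x hx) t)
  rw [apply_add_eq, map_smul, ← IsometryEquiv.mul_apply, ← map_mul] at h
  simpa using h

/-- If points `c n` of a closed convex set `C` satisfy `c n / n → w`, then `C` is stable under
translation by nonnegative multiples of `w`. -/
theorem Convex.add_smul_mem_of_tendsto_inv_smul {H : Type*} [NormedAddCommGroup H]
    [NormedSpace ℝ H] {C : Set H} (hconv : Convex ℝ C) (hC : IsClosed C) {c : ℕ → H} {w : H}
    (hc : ∀ n, c n ∈ C) (hw : Tendsto (fun n : ℕ => (n : ℝ)⁻¹ • c n) atTop (𝓝 w))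
    {x : H} (hx : x ∈ C) {t : ℝ} (ht : 0 ≤ t) : x + t • w ∈ C := by
  have hinv : Tendsto (fun n : ℕ => (n : ℝ)⁻¹) atTop (𝓝 0) :=
    tendsto_inv_atTop_nhds_zero_nat
  -- Weight `t / n` on `c n` makes the convex combination converge to `x + t • w`.
  have hlim : Tendsto (fun n : ℕ => (1 - t * (n : ℝ)⁻¹) • x + (t * (n : ℝ)⁻¹) • c n) atTop
      (𝓝 (x + t • w)) := by
    have h1 := ((tendsto_const_nhds (x := (1 : ℝ))).sub (hinv.const_mul t)).smul_const x
    have h2 := hw.const_smul t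
    simpa [smul_smul] using h1.add h2
  refine hC.mem_of_tendsto hlim ?_
  have hsmall : ∀ᶠ n : ℕ in atTop, t * (n : ℝ)⁻¹ < 1 :=
    (hinv.const_mul t).eventually_lt_const (by simp)
  filter_upwards [hsmall] with n hn
  exact hconv hx (hc n) (by linarith) (by positivity) (by ring)

/-- Iterating the cocycle relation puts the orbit of `0` in the form required by the ergodic
theorem. -/
theorem apply_pow_zero_eq_birkhoffSum {G H : Type*} [Group G] [NormedAddCommGroup H]
    [InnerProductSpace ℝ H] (α : G →* (H ≃ᵢ H)) (g : G) (n : ℕ) :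
    α (g ^ n) 0 = birkhoffSum (linearPart α g) _root_.id n (α g 0) := by
  induction n with
  | zero => simp
  | succ n ih =>
    rw [birkhoffSum_succ', pow_succ', map_mul, IsometryEquiv.mul_apply,
      apply_eq_linearPart_add α g, ih, add_comm]
    congr 1
    rw [birkhoffSum, birkhoffSum, map_sum]
    exact Finset.sum_congr rfl fun k _ => (Function.iterate_succ_apply' _ k _).symm.trans
      (Function.iterate_succ_apply _ k _)

/-- The orbit of the origin has an asymptotic drift, which is fixed by the linear part. -/
theorem exists_tendsto_inv_smul_apply_pow {G H : Type*} [Group G] [NormedAddCommGroup H]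
    [InnerProductSpace ℝ H] [CompleteSpace H] (α : G →* (H ≃ᵢ H)) (g : G) :
    ∃ w : H, linearPart α g w = w ∧
      Tendsto (fun n : ℕ => (n : ℝ)⁻¹ • α (g ^ n) 0) atTop (𝓝 w) := by
  let U : H →L[ℝ] H := (linearPart α g).toContinuousLinearEquiv
  have hU : ‖U‖ ≤ 1 := U.opNorm_le_bound zero_le_one fun v => by simp [U]
  have h := U.tendsto_birkhoffAverage_orthogonalProjection hU (α g 0)
  refine ⟨_, ?_, h.congr fun n => ?_⟩
  · exact Submodule.coe_mem ((U.eqLocus (1 : H →L[ℝ] H)).orthogonalProjectionOnto (α g 0))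
  · rw [apply_pow_zero_eq_birkhoffSum]
    rfl

/-- The displacement length is bounded by the norm of the drift. -/
theorem displacementLength_le_norm_of_tendsto {G H : Type*} [Group G] [NormedAddCommGroup H]
    [InnerProductSpace ℝ H] (α : G →* (H ≃ᵢ H)) (g : G) {w : H}
    (hw : Tendsto (fun n : ℕ => (n : ℝ)⁻¹ • α (g ^ n) 0) atTop (𝓝 w)) :
    displacementLength (α g) ≤ ‖w‖ := by
  refine ge_of_tendsto hw.norm ?_
  filter_upwards [eventually_gt_atTop 0] with n hn
  have hn0 : (n : ℝ) ≠ 0 := by positivity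
  -- For the mean of the first `n` orbit points, `α g v - v` telescopes.
  let v : H := (n : ℝ)⁻¹ • ∑ k ∈ Finset.range n, α (g ^ k) 0
  have hv : α g v - v = (n : ℝ)⁻¹ • α (g ^ n) 0 := by
    have hb : α g 0 = (n : ℝ)⁻¹ • ∑ _k ∈ Finset.range n, α g 0 := by
      rw [Finset.sum_const, Finset.card_range, ← Nat.cast_smul_eq_nsmul ℝ, smul_smul,
        inv_mul_cancel₀ hn0, one_smul]
    have hs : ∀ k : ℕ, linearPart α g (α (g ^ k) 0) + α g 0 = α (g ^ (k + 1)) 0 := fun k => by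
      rw [← apply_eq_linearPart_add, pow_succ', map_mul, IsometryEquiv.mul_apply]
    rw [apply_eq_linearPart_add, hb, map_smul, map_sum, ← smul_add, ← Finset.sum_add_distrib,
      ← smul_sub, ← Finset.sum_sub_distrib]
    simp only [hs]
    rw [Finset.sum_range_sub (fun k => α (g ^ k) 0)]
    simp
  rw [← hv, ← dist_eq_norm]
  exact ciInf_le ⟨0, by rintro _ ⟨x, rfl⟩; exact dist_nonneg⟩ v

theorem linearPart_pow_apply_of_fixed {G H : Type*} [Group G] [NormedAddCommGroup H]
    [InnerProductSpace ℝ H] (α : G →* (H ≃ᵢ H)) {g : G} {w : H}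
    (hw : linearPart α g w = w) (n : ℕ) : linearPart α (g ^ n) w = w := by
  induction n with
  | zero => simp
  | succ n ih => rw [pow_succ, map_mul, LinearIsometryEquiv.coe_mul, Function.comp_apply, hw, ih]

/-- The drift does not depend on the base point. -/
theorem tendsto_inv_smul_apply_pow {G H : Type*} [Group G] [NormedAddCommGroup H]
    [InnerProductSpace ℝ H] (α : G →* (H ≃ᵢ H)) (g : G) {w : H}
    (h : Tendsto (fun n : ℕ => (n : ℝ)⁻¹ • α (g ^ n) 0) atTop (𝓝 w)) (x : H) :
    Tendsto (fun n : ℕ => (n : ℝ)⁻¹ • α (g ^ n) x) atTop (𝓝 w) := by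
  have h0 : Tendsto (fun n : ℕ => (n : ℝ)⁻¹ • linearPart α (g ^ n) x) atTop (𝓝 0) := by
    rw [tendsto_zero_iff_norm_tendsto_zero]
    simpa [norm_smul] using
      (tendsto_inv_atTop_nhds_zero_nat (𝕜 := ℝ)).mul_const ‖x‖
  have h1 := h0.add h
  rw [zero_add] at h1
  exact h1.congr fun n => by rw [← smul_add, ← apply_eq_linearPart_add]

/-- The drift of the inverse is the opposite of the drift. -/
theorem tendsto_inv_smul_apply_pow_inv {G H : Type*} [Group G] [NormedAddCommGroup H]
    [InnerProductSpace ℝ H] (α : G →* (H ≃ᵢ H)) (g : G) {w : H} (hw : linearPart α g w = w)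
    (h : Tendsto (fun n : ℕ => (n : ℝ)⁻¹ • α (g ^ n) 0) atTop (𝓝 w)) :
    Tendsto (fun n : ℕ => (n : ℝ)⁻¹ • α (g ^ n)⁻¹ 0) atTop (𝓝 (-w)) := by
  rw [tendsto_iff_norm_sub_tendsto_zero] at h ⊢
  refine h.congr' ?_
  filter_upwards [eventually_gt_atTop 0] with n hn
  have hn0 : (n : ℝ) ≠ 0 := by positivity
  -- Apply the isometry `α (g ^ n)`, whose linear part fixes `w`.
  have hd : dist (α (g ^ n)⁻¹ 0) (0 + (-(n : ℝ)) • w) = dist 0 (α (g ^ n) 0 + (-(n : ℝ)) • w) := by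
    rw [← (α (g ^ n)).dist_eq, apply_add_eq, map_smul, linearPart_pow_apply_of_fixed α hw,
      ← IsometryEquiv.mul_apply, ← map_mul]
    simp
  have e1 : (n : ℝ)⁻¹ • α (g ^ n) 0 - w = (n : ℝ)⁻¹ • (α (g ^ n) 0 + (-(n : ℝ)) • w) := by
    rw [smul_add, smul_smul, mul_neg, inv_mul_cancel₀ hn0, neg_one_smul, sub_eq_add_neg]
  have e2 : (n : ℝ)⁻¹ • α (g ^ n)⁻¹ 0 - -w =
      (n : ℝ)⁻¹ • (α (g ^ n)⁻¹ 0 - (0 + (-(n : ℝ)) • w)) := by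
    rw [zero_add, smul_sub, smul_smul, mul_neg, inv_mul_cancel₀ hn0, neg_one_smul]
  rw [e1, e2, norm_smul, norm_smul, ← dist_eq_norm, hd, dist_zero_left]

/-- The drift of an element lies in the lineality space of every invariant closed convex set. -/
theorem mem_linealitySubmodule_of_tendsto {G H : Type*} [Group G] [NormedAddCommGroup H]
    [InnerProductSpace ℝ H] (α : G →* (H ≃ᵢ H)) {C : Set H} (hC : IsClosed C)
    (hconv : Convex ℝ C) (hinv : ∀ g : G, ∀ x ∈ C, α g x ∈ C) {g : G} {w : H}
    (hw : linearPart α g w = w)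
    (h : Tendsto (fun n : ℕ => (n : ℝ)⁻¹ • α (g ^ n) 0) atTop (𝓝 w)) :
    w ∈ linealitySubmodule C := by
  intro x hx t
  rcases le_total 0 t with ht | ht
  · exact hconv.add_smul_mem_of_tendsto_inv_smul hC (fun n => hinv (g ^ n) x hx)
      (tendsto_inv_smul_apply_pow α g h x) hx ht
  -- For `t ≤ 0`, write `t • w = (-t) • (-w)` and use the drift of `g⁻¹`.
  · have h' := tendsto_inv_smul_apply_pow_inv α g hw h
    simp only [← inv_pow] at h'
    have := hconv.add_smul_mem_of_tendsto_inv_smul hC (fun n => hinv (g⁻¹ ^ n) x hx)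
      (tendsto_inv_smul_apply_pow α g⁻¹ h' x) hx (neg_nonneg.2 ht)
    simpa using this

theorem mainTheorem9 {G H : Type*} [Group G] [TopologicalSpace G] [IsTopologicalGroup G]
    [LocallyCompactSpace G] [MeasurableSpace G] [BorelSpace G]
    [NormedAddCommGroup H] [InnerProductSpace ℝ H] [CompleteSpace H]
    (K : Subgroup G) (hGK : IsGelfandPair K) (hG : IsCompactlyGeneratedGroup G)
    (α : G →* (H ≃ᵢ H)) (hα : Continuous fun p : G × H => α p.1 p.2)
    (hirr : IsTopIrreducible (linearPart α))
    (hdisp : ∃ g : G, 0 < displacementLength (α g)) (C : Set H) :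
    (C.Nonempty ∧ IsClosed C ∧ Convex ℝ C ∧ ∀ g : G, ∀ x ∈ C, α g x ∈ C) ↔ C = Set.univ := by
  constructor
  · rintro ⟨hne, hC, hconv, hinv⟩
    obtain ⟨g, hg⟩ := hdisp
    obtain ⟨w, hw, hlim⟩ := exists_tendsto_inv_smul_apply_pow α g
    have hw0 : w ≠ 0 :=
      norm_pos_iff.1 (hg.trans_le (displacementLength_le_norm_of_tendsto α g hlim))
    have hmem := mem_linealitySubmodule_of_tendsto α hC hconv hinv hw hlim
    rcases hirr.eq_bot_or_eq_top _ (isClosed_linealitySubmodule hC)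
      (fun g _ hv => linearPart_mem_linealitySubmodule α hinv g hv) with hbot | htop
    · rw [hbot] at hmem
      exact absurd ((Submodule.mem_bot ℝ).1 hmem) hw0
    · exact eq_univ_of_linealitySubmodule_eq_top hne htop
  · rintro rfl
    exact ⟨Set.univ_nonempty, isClosed_univ, convex_univ, fun _ _ _ => Set.mem_univ _⟩
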